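/- All Hilbert spaces are complex and finite-dimensional, $\mathcal{L}(\mathcal{H})$ denotes the linear operators on $\mathcal{H}$, and a quantum channel is a completely positive trace-preserving linear map $\mathcal{L}(\mathcal{H})\to\mathcal{L}(\mathcal{H}')$. Let $\mathcal{H}=(\mathcal{H}^A\otimes\mathcal{H}^B)\oplus\mathcal{K}$ with $\mathcal{K}=(\mathcal{H}^A\otimes\mathcal{H}^B)^{\perp}$, let $P_{AB}$ be the orthogonal projector of $\mathcal{H}$ onto $\mathcal{H}^A\otimes\mathcal{H}^B$, and let $\mathcal{P}_{AB}(\sigma)=P_{AB}\,\sigma\,P_{AB}$. Let $\mathcal{E}:\mathcal{L}(\mathcal{H})\to\mathcal{L}(\mathcal{H})$ be a quantum channel. Then the following are equivalent. (i) $B$ is a correctable subsystem for $\mathcal{E}$: there are quantum channels $\mathcal{R}:\mathcal{L}(\mathcal{H})\to\mathcal{L}(\mathcal{H})$ and $\mathcal{F}_A:\mathcal{L}(\mathcal{H}^A)\to\mathcal{L}(\mathcal{H}^A)$ such that $$\mathcal{R}\circ\mathcal{E}\circ\mathcal{P}_{AB}=\mathcal{F}_A\otimes\mathrm{id}_B .$$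 (ii) $B$ is a unitarily recoverable subsystem for $\mathcal{E}$: there are a unitary operator $U$ on $\mathcal{H}$, a Hilbert space $\mathcal{H}^C$ (possibly different from $\mathcal{H}^A$, also in dimension) with a decomposition $\mathcal{H}=(\mathcal{H}^C\otimes\mathcal{H}^B)\oplus\mathcal{K}'$, $\mathcal{K}'=(\mathcal{H}^C\otimes\mathcal{H}^B)^{\perp}$, and a quantum channel $\mathcal{F}_{C|A}:\mathcal{L}(\mathcal{H}^A)\to\mathcal{L}(\mathcal{H}^C)$ such that, with $\mathcal{U}(\sigma)=U\sigma U^{\dagger}$, $$\mathcal{U}\circ\mathcal{E}\circ\mathcal{P}_{AB}=\mathcal{F}_{C|A}\otimes\mathrm{id}_B .$$ Here $\mathrm{id}_B$ is the identity map on $\mathcal{L}(\mathcal{H}^B)$, and the right-hand sides denote the natural extensions to $\mathcal{L}(\mathcal{H})$: the input is first compressed to $\mathcal{H}^A\otimes\mathcal{H}^B$, and the output acts on $\mathcal{H}^A\otimes\mathcal{H}^B$ (respectively $\mathcal{H}^C\otimes\mathcal{H}^B$) and as zero on its orthogonal complement. -/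

import Mathlib

open scoped TensorProduct CStarAlgebra

namespace QuantumSubsystem

noncomputable section

universe u v w

/-- `L(H)`, the operators on a (finite-dimensional) Hilbert space `H`. -/
abbrev Op (H : Type u) [NormedAddCommGroup H] [InnerProductSpace ℂ H] : Type u :=
  H →L[ℂ] H

/-- A quantum channel (quantum operation) from `H` to `K`: a completely positive
trace-preserving linear map `L(H) → L(K)`. -/
structure Channel (H : Type u) (K : Type v)
    [NormedAddCommGroup H] [InnerProductSpace ℂ H] [FiniteDimensional ℂ H]
    [NormedAddCommGroup K] [InnerProductSpace ℂ K] [FiniteDimensional ℂ K]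
    extends Op H →CP Op K where
  trace_preserving : ∀ σ : Op H,
    LinearMap.trace ℂ K (toLinearMap σ : K →ₗ[ℂ] K) = LinearMap.trace ℂ H (σ : H →ₗ[ℂ] H)

/-- The superoperator `σ ↦ V σ V†`. -/
def conj {H : Type u} {K : Type v}
    [NormedAddCommGroup H] [InnerProductSpace ℂ H] [FiniteDimensional ℂ H]
    [NormedAddCommGroup K] [InnerProductSpace ℂ K] [FiniteDimensional ℂ K]
    (V : H →L[ℂ] K) : Op H →ₗ[ℂ] Op K where
  toFun σ := V ∘L σ ∘L ContinuousLinearMap.adjoint V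
  map_add' σ τ := by ext x; simp
  map_smul' c σ := by ext x; simp

/-- The canonical isomorphism `L(A) ⊗ L(B) ≃ L(A ⊗ B)`, `a ⊗ b ↦ a ⊗ b`. -/
def opTensor (A : Type u) (B : Type v)
    [NormedAddCommGroup A] [InnerProductSpace ℂ A] [FiniteDimensional ℂ A]
    [NormedAddCommGroup B] [InnerProductSpace ℂ B] [FiniteDimensional ℂ B] :
    Op A ⊗[ℂ] Op B ≃ₗ[ℂ] Op (A ⊗[ℂ] B) :=
  TensorProduct.congr LinearMap.toContinuousLinearMap.symm LinearMap.toContinuousLinearMap.symm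
    ≪≫ₗ homTensorHomEquiv ℂ A B A B ≪≫ₗ LinearMap.toContinuousLinearMap

/-- The superoperator `F ⊗ id_B : L(A ⊗ B) → L(C ⊗ B)`. -/
def tensorId {A : Type u} {C : Type v} (B : Type w)
    [NormedAddCommGroup A] [InnerProductSpace ℂ A] [FiniteDimensional ℂ A]
    [NormedAddCommGroup C] [InnerProductSpace ℂ C] [FiniteDimensional ℂ C]
    [NormedAddCommGroup B] [InnerProductSpace ℂ B] [FiniteDimensional ℂ B]
    (F : Op A →ₗ[ℂ] Op C) : Op (A ⊗[ℂ] B) →ₗ[ℂ] Op (C ⊗[ℂ] B) :=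
  (opTensor C B).toLinearMap ∘ₗ F.rTensor (Op B) ∘ₗ (opTensor A B).symm.toLinearMap

/-! A decomposition `H = (A ⊗ B) ⊕ K` with `K = (A ⊗ B)ᗮ` is given by a linear isometry
`ι : A ⊗ B → H`, the embedding of the first summand; `K` is the complement of its range. -/

/-- The superoperator `P_AB : σ ↦ P σ P`, where `P` is the orthogonal projector of `H` onto the
subspace `A ⊗ B`, for `H = (A ⊗ B) ⊕ K` given by `ι`. -/
def compress {H : Type u} {A : Type v} {B : Type w}
    [NormedAddCommGroup H] [InnerProductSpace ℂ H] [FiniteDimensional ℂ H]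
    [NormedAddCommGroup A] [InnerProductSpace ℂ A] [FiniteDimensional ℂ A]
    [NormedAddCommGroup B] [InnerProductSpace ℂ B] [FiniteDimensional ℂ B]
    (ι : (A ⊗[ℂ] B) →ₗᵢ[ℂ] H) : Op H →ₗ[ℂ] Op H where
  toFun σ := (LinearMap.range ι.toLinearMap).starProjection ∘L σ ∘L
    (LinearMap.range ι.toLinearMap).starProjection
  map_add' σ τ := by ext x; simp
  map_smul' c σ := by ext x; simp

/-- The natural extension to `L(H)` of a superoperator `Φ : L(A ⊗ B) → L(C ⊗ B)`, for
decompositions `H = (A ⊗ B) ⊕ K` and `H = (C ⊗ B) ⊕ K'` given by `ι` and `κ`: compress the input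
to `A ⊗ B`, apply `Φ`, and let the output act on `C ⊗ B` (and as zero on `K'`). -/
def extend {H : Type u} {A : Type v} {B : Type w} {C : Type v}
    [NormedAddCommGroup H] [InnerProductSpace ℂ H] [FiniteDimensional ℂ H]
    [NormedAddCommGroup A] [InnerProductSpace ℂ A] [FiniteDimensional ℂ A]
    [NormedAddCommGroup B] [InnerProductSpace ℂ B] [FiniteDimensional ℂ B]
    [NormedAddCommGroup C] [InnerProductSpace ℂ C] [FiniteDimensional ℂ C]
    (ι : (A ⊗[ℂ] B) →ₗᵢ[ℂ] H) (κ : (C ⊗[ℂ] B) →ₗᵢ[ℂ] H)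
    (Φ : Op (A ⊗[ℂ] B) →ₗ[ℂ] Op (C ⊗[ℂ] B)) : Op H →ₗ[ℂ] Op H :=
  conj κ.toContinuousLinearMap ∘ₗ Φ ∘ₗ
    conj (ContinuousLinearMap.adjoint ι.toContinuousLinearMap)

/-- `B` is a correctable subsystem for `E`: there are channels `R` on `H` and `F_A` on `A` with
`R ∘ E ∘ P_AB = F_A ⊗ id_B`. -/
def IsCorrectable {H : Type u} {A : Type v} {B : Type w}
    [NormedAddCommGroup H] [InnerProductSpace ℂ H] [FiniteDimensional ℂ H]
    [NormedAddCommGroup A] [InnerProductSpace ℂ A] [FiniteDimensional ℂ A]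
    [NormedAddCommGroup B] [InnerProductSpace ℂ B] [FiniteDimensional ℂ B]
    (ι : (A ⊗[ℂ] B) →ₗᵢ[ℂ] H) (E : Channel H H) : Prop :=
  ∃ (R : Channel H H) (F : Channel A A),
    R.toLinearMap ∘ₗ E.toLinearMap ∘ₗ compress ι = extend ι ι (tensorId B F.toLinearMap)

/-- `B` is a unitarily recoverable subsystem for `E`: there are a unitary `U` on `H`, a further
decomposition `H = (C ⊗ B) ⊕ K'` and a channel `F_{C|A}` from `A` to `C` with
`U ∘ E ∘ P_AB = F_{C|A} ⊗ id_B`, where the first factor is `σ ↦ U σ U†`. -/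
def IsUnitarilyRecoverable {H : Type u} {A : Type v} {B : Type w}
    [NormedAddCommGroup H] [InnerProductSpace ℂ H] [FiniteDimensional ℂ H]
    [NormedAddCommGroup A] [InnerProductSpace ℂ A] [FiniteDimensional ℂ A]
    [NormedAddCommGroup B] [InnerProductSpace ℂ B] [FiniteDimensional ℂ B]
    (ι : (A ⊗[ℂ] B) →ₗᵢ[ℂ] H) (E : Channel H H) : Prop :=
  ∃ U ∈ unitary (Op H),
  ∃ (C : Type v) (_ : NormedAddCommGroup C) (_ : InnerProductSpace ℂ C)
    (_ : FiniteDimensional ℂ C) (κ : (C ⊗[ℂ] B) →ₗᵢ[ℂ] H) (F : Channel A C),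
    conj U ∘ₗ E.toLinearMap ∘ₗ compress ι = extend ι κ (tensorId B F.toLinearMap)

end

end QuantumSubsystem

/-! Let `e i` and `r j` be Kraus operators of `E` and of a recovery `R`. On the pure state of `a ⊗
b`, correctability makes a sum of rank one operators equal to one with range in `A ⊗ b`, so every `r
j (e i (a ⊗ b))` lies in `A ⊗ b` (`mem_of_sum_rankOne_apply_mem`). Since the `r j` together form an
isometry, `e i (a ⊗ b)` and `e k (a' ⊗ b')` are orthogonal whenever `b` and `b'` are. A sesquilinear
form on `B` with this property is a multiple of the inner product (`inner_eq_mul_of_orthogonal`).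
Hence the images of `A ⊗ B` under all `e i` span an isometric copy of some `C ⊗ B`, on which each `e
i` takes the form `f i ⊗ id` (`exists_isometry_factor`), and the `f i` are Kraus operators of the
required channel. The embedding of `C ⊗ B` is free, so `U = 1` suffices.

Conversely, applying `U`, discarding `C` and preparing a fixed pure state of `A` is a recovery
(`exists_channel_reset`). Both directions are checked on product vectors through
`comp_compress_eq_extend_iff`. -/

namespace QuantumSubsystem

open InnerProductSpace ContinuousLinearMap

universe v

/-! ### Conjugation maps and rank one operators. -/

section Conj

variable {H K L : Type*}
  [NormedAddCommGroup H] [InnerProductSpace ℂ H] [FiniteDimensional ℂ H]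
  [NormedAddCommGroup K] [InnerProductSpace ℂ K] [FiniteDimensional ℂ K]
  [NormedAddCommGroup L] [InnerProductSpace ℂ L] [FiniteDimensional ℂ L]

theorem conj_apply (V : H →L[ℂ] K) (σ : Op H) : conj V σ = V ∘L σ ∘L adjoint V := rfl

@[simp]
theorem conj_rankOne (V : H →L[ℂ] K) (x y : H) :
    conj V (rankOne ℂ x y) = rankOne ℂ (V x) (V y) := by
  ext z
  simp [conj_apply, adjoint_inner_right]

@[simp]
theorem conj_zero (σ : Op H) : conj (0 : H →L[ℂ] K) σ = 0 := by
  simp [conj_apply]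

theorem conj_comp (V : K →L[ℂ] L) (W : H →L[ℂ] K) (σ : Op H) :
    conj (V ∘L W) σ = conj V (conj W σ) := by
  simp [conj_apply, adjoint_comp, comp_assoc]

theorem op_eq_sum_rankOne {H : Type*} [NormedAddCommGroup H] [InnerProductSpace ℂ H]
    {ι : Type*} [Fintype ι] (b : OrthonormalBasis ι ℂ H) (σ : Op H) :
    σ = ∑ i, rankOne ℂ (σ (b i)) (b i) := by
  ext z
  conv_lhs => rw [← b.sum_repr' z]
  simp

/-- Linear maps on `L(H)` are determined by their values on rank one operators. -/
theorem ext_rankOne {M : Type*} [AddCommGroup M] [Module ℂ M] {Φ Ψ : Op H →ₗ[ℂ] M}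
    (h : ∀ x y, Φ (rankOne ℂ x y) = Ψ (rankOne ℂ x y)) : Φ = Ψ := by
  ext σ
  rw [op_eq_sum_rankOne (stdOrthonormalBasis ℂ H) σ]
  simp [h]

end Conj

/-! ### Kraus form of completely positive maps. -/

section Kraus

theorem exists_eq_star_mul_self {R : Type*} [NonUnitalCStarAlgebra R] [PartialOrder R]
    [StarOrderedRing R] {a : R} (ha : 0 ≤ a) : ∃ b, a = star b * b :=
  CStarAlgebra.nonneg_iff_eq_star_mul_self.mp ha

theorem cstarMatrix_sum_apply {R ι n : Type*} [AddCommMonoid R] [Fintype ι]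
    (M : ι → CStarMatrix n n R) (i j : n) : (∑ m, M m) i j = ∑ m, M m i j := by
  let f : CStarMatrix n n R →+ R := ⟨⟨fun M => M i j, rfl⟩, fun _ _ => rfl⟩
  exact map_sum f M _

variable {H K : Type*}
  [NormedAddCommGroup H] [InnerProductSpace ℂ H] [FiniteDimensional ℂ H]
  [NormedAddCommGroup K] [InnerProductSpace ℂ K] [FiniteDimensional ℂ K]

/-- The compression of `star N * N` by `V` is a sum of operators of the form `star P * P`. -/
theorem conj_star_mul (V : H →L[ℂ] K) {ι : Type*} [Fintype ι] (b : OrthonormalBasis ι ℂ H)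
    (k : K) (hk : ‖k‖ = 1) (S T : Op H) :
    conj V (star S * T) = ∑ m, star (rankOne ℂ k (b m) ∘L S ∘L adjoint V)
      * (rankOne ℂ k (b m) ∘L T ∘L adjoint V) := by
  have hkk : inner ℂ k k = (1 : ℂ) := by simp [inner_self_eq_norm_sq_to_K, hk]
  ext z
  simp only [conj_apply, star_eq_adjoint, adjoint_comp, adjoint_adjoint, adjoint_rankOne,
    _root_.sum_apply, mul_apply_eq_comp, ContinuousLinearMap.comp_apply,
    rankOne_apply, hkk, map_smul]
  -- The resolution of the identity in the basis `b` is inserted between `star S` and `T`; the unit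
  -- vector `k` only serves to bring each factor into `Op K`.
  conv_lhs => rw [← b.sum_repr' (T (adjoint V z))]
  simp

/-- Complete positivity of `conj V`: a positive matrix is `star N * N`, which `conj_star_mul` turns
entrywise into a sum of such squares. -/
theorem conj_map_nonneg (V : H →L[ℂ] K) {n : Type*} [Fintype n]
    (M : CStarMatrix n n (Op H)) (hM : 0 ≤ M) : 0 ≤ M.map (conj V) := by
  classical
  rcases subsingleton_or_nontrivial K with hK | hK
  · have : M.map (conj V) = 0 := by
      ext i j z
      exact Subsingleton.elim _ _
    rw [this]
  obtain ⟨k, hk⟩ := exists_norm_eq K zero_le_one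
  obtain ⟨N, rfl⟩ := exists_eq_star_mul_self hM
  let b := stdOrthonormalBasis ℂ H
  let P (m) : CStarMatrix n n (Op K) := N.map fun S => rankOne ℂ k (b m) ∘L S ∘L adjoint V
  have : (star N * N).map (conj V) = ∑ m, star (P m) * P m := by
    ext1 i j
    rw [cstarMatrix_sum_apply]
    simp only [CStarMatrix.map_apply, CStarMatrix.mul_apply, CStarMatrix.star_apply, map_sum]
    simp_rw [conj_star_mul V b k hk]
    rw [Finset.sum_comm]
    rfl
  rw [this]
  exact Finset.sum_nonneg fun m _ => star_mul_self_nonneg _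

/-- The channel with a given family of Kraus operators. -/
noncomputable def Channel.ofKraus {ι : Type*} [Fintype ι] (V : ι → H →L[ℂ] K)
    (hV : ∀ x y, ∑ i, inner ℂ (V i x) (V i y) = inner ℂ x y) : Channel H K where
  toLinearMap := ∑ i, conj (V i)
  map_cstarMatrix_nonneg' k M hM := by
    have : M.map (∑ i, conj (V i) : Op H →ₗ[ℂ] Op K) = ∑ i, M.map (conj (V i)) := by
      ext1 p q
      rw [cstarMatrix_sum_apply]
      simp [CStarMatrix.map_apply]
    exact this ▸ Finset.sum_nonneg fun i _ => conj_map_nonneg _ _ hM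
  trace_preserving σ := by
    let Φ : Op H →ₗ[ℂ] ℂ := LinearMap.trace ℂ K ∘ₗ
      LinearMap.toContinuousLinearMap.symm.toLinearMap ∘ₗ ∑ i, conj (V i)
    let Ψ : Op H →ₗ[ℂ] ℂ := LinearMap.trace ℂ H ∘ₗ
      LinearMap.toContinuousLinearMap.symm.toLinearMap
    suffices h : Φ = Ψ from LinearMap.congr_fun h σ
    refine ext_rankOne fun x y => ?_
    change LinearMap.trace ℂ K ((((∑ i, conj (V i)) (rankOne ℂ x y) : Op K)) : K →ₗ[ℂ] K) =
      LinearMap.trace ℂ H ((rankOne ℂ x y : Op H) : H →ₗ[ℂ] H)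
    simp [trace_rankOne, hV]

@[simp]
theorem Channel.ofKraus_toLinearMap {ι : Type*} [Fintype ι] (V : ι → H →L[ℂ] K)
    (hV : ∀ x y, ∑ i, inner ℂ (V i x) (V i y) = inner ℂ x y) :
    (Channel.ofKraus V hV).toLinearMap = ∑ i, conj (V i) := rfl

/-- Choi's theorem: a completely positive map has a finite family of Kraus operators. -/
theorem exists_kraus (E : Op H →CP Op K) :
    ∃ (n : ℕ) (V : Fin n → H →L[ℂ] K), E.toLinearMap = ∑ i, conj (V i) := by
  classical
  let b := stdOrthonormalBasis ℂ H
  let c := stdOrthonormalBasis ℂ K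
  suffices h : ∃ (ι : Type) (_ : Fintype ι) (V : ι → H →L[ℂ] K),
      E.toLinearMap = ∑ i, conj (V i) by
    obtain ⟨ι, _, V, h⟩ := h
    refine ⟨Fintype.card ι, V ∘ (Fintype.equivFin ι).symm, h.trans ?_⟩
    exact ((Fintype.equivFin ι).symm.sum_comp fun i => conj (V i)).symm
  rcases subsingleton_or_nontrivial H with hH | hH
  · refine ⟨Empty, inferInstance, Empty.elim, ?_⟩
    ext σ : 1
    rw [Subsingleton.elim σ 0, map_zero, map_zero]
  obtain ⟨e, he⟩ := exists_norm_eq H zero_le_one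
  -- The image of `M` under `E` is the Choi matrix. `M` itself is the square of a matrix supported
  -- in one arbitrary row `j₀`.
  let M : CStarMatrix (Fin (Module.finrank ℂ H)) (Fin (Module.finrank ℂ H)) (Op H) :=
    CStarMatrix.ofMatrix fun i j => rankOne ℂ (b i) (b j)
  obtain ⟨j₀⟩ : Nonempty (Fin (Module.finrank ℂ H)) := ⟨⟨0, Module.finrank_pos⟩⟩
  have hM : 0 ≤ M := by
    let N : CStarMatrix (Fin (Module.finrank ℂ H)) (Fin (Module.finrank ℂ H)) (Op H) :=
      CStarMatrix.ofMatrix fun i j => if i = j₀ then rankOne ℂ e (b j) else 0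
    have hN (i j) : N i j = if i = j₀ then rankOne ℂ e (b j) else 0 := rfl
    have : M = star N * N := by
      ext1 i j
      change rankOne ℂ (b i) (b j) = (star N * N) i j
      simp only [CStarMatrix.mul_apply, CStarMatrix.star_apply]
      rw [Finset.sum_eq_single j₀]
      · ext z
        simp [hN, star_eq_adjoint, he]
      · intro k _ hk
        simp [hN, hk]
      · simp
    rw [this]
    exact star_mul_self_nonneg _
  obtain ⟨N, hN⟩ := exists_eq_star_mul_self
    (E.map_cstarMatrix_nonneg M hM)
  have hE (i j) : E.toLinearMap (rankOne ℂ (b i) (b j)) = ∑ k, star (N k i) * N k j := by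
    have := congrFun (congrFun hN i) j
    simp only [CStarMatrix.mul_apply, CStarMatrix.star_apply] at this
    exact this
  -- Inserting the basis `c` into each product `star (N k i) * N k j` leaves rank one operators
  -- between the vectors `V p (b i)` and `V p (b j)`.
  let V (p : Fin (Module.finrank ℂ H) × Fin (Module.finrank ℂ K)) : H →L[ℂ] K :=
    ∑ i, rankOne ℂ (adjoint (N p.1 i) (c p.2)) (b i)
  have hV (p i) : V p (b i) = adjoint (N p.1 i) (c p.2) := by
    simp [V, _root_.sum_apply, b.inner_eq_ite]
  refine ⟨_, inferInstance, V, ?_⟩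
  have key (i j) : E.toLinearMap (rankOne ℂ (b i) (b j)) =
      (∑ p, conj (V p)) (rankOne ℂ (b i) (b j)) := by
    rw [hE]
    ext z
    simp only [LinearMap.sum_apply, conj_rankOne, hV, _root_.sum_apply,
      rankOne_apply, adjoint_inner_left, Fintype.sum_prod_type, mul_apply_eq_comp,
      star_eq_adjoint]
    refine Finset.sum_congr rfl fun k _ => ?_
    conv_lhs => rw [← c.sum_repr' (N k j z)]
    simp
  refine ext_rankOne fun x y => ?_
  rw [← b.sum_repr' x, ← b.sum_repr' y]
  simp only [map_sum, map_smul, _root_.sum_apply, _root_.smul_apply,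
    map_smulₛₗ, key]

end Kraus

/-! ### Reduction to product vectors. -/

section RankOne

/-- Gram forms of linear maps on a tensor product can be compared on product vectors. -/
theorem inner_tmul_ext {A B M K : Type*} [AddCommGroup A] [Module ℂ A]
    [AddCommGroup B] [Module ℂ B] [NormedAddCommGroup M] [InnerProductSpace ℂ M]
    [NormedAddCommGroup K] [InnerProductSpace ℂ K]
    {S T : A ⊗[ℂ] B →ₗ[ℂ] M}
    {S' T' : A ⊗[ℂ] B →ₗ[ℂ] K}
    (h : ∀ (a a' : A) (b b' : B), inner ℂ (S (a ⊗ₜ b)) (T (a' ⊗ₜ b'))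
      = inner ℂ (S' (a ⊗ₜ b)) (T' (a' ⊗ₜ b'))) (x y : A ⊗[ℂ] B) :
    inner ℂ (S x) (T y) = inner ℂ (S' x) (T' y) := by
  induction x with
  | zero => simp
  | add x x' hx hx' => simp only [map_add, inner_add_left, hx, hx']
  | tmul a b =>
    induction y with
    | zero => simp
    | add y y' hy hy' => simp only [map_add, inner_add_right, hy, hy']
    | tmul a' b' => exact h a a' b b'

theorem mapL_rankOne {A B : Type*} [NormedAddCommGroup A] [InnerProductSpace ℂ A]
    [NormedAddCommGroup B] [InnerProductSpace ℂ B] (a a' : A) (b b' : B) :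
    TensorProduct.mapL (rankOne ℂ a a') (rankOne ℂ b b')
      = rankOne ℂ (a ⊗ₜ[ℂ] b) (a' ⊗ₜ[ℂ] b') := by
  ext z
  induction z with
  | zero => simp
  | add x y hx hy => rw [map_add, map_add, hx, hy]
  | tmul x y => simp [rankOne_apply, TensorProduct.smul_tmul', smul_smul, mul_comm]

theorem mapL_sum_left {A B C D : Type*} [NormedAddCommGroup A] [InnerProductSpace ℂ A]
    [NormedAddCommGroup B] [InnerProductSpace ℂ B] [NormedAddCommGroup C] [InnerProductSpace ℂ C]
    [NormedAddCommGroup D] [InnerProductSpace ℂ D] {ι : Type*} [Fintype ι]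
    (α : ι → A →L[ℂ] C) (β : B →L[ℂ] D) :
    TensorProduct.mapL (∑ i, α i) β = ∑ i, TensorProduct.mapL (α i) β := by
  exact map_sum (AddMonoidHom.mk' (fun α : A →L[ℂ] C => TensorProduct.mapL α β)
    fun α α' => TensorProduct.mapL_add_left α α' β) α _

section Tensor

variable {H K A B C : Type*}
  [NormedAddCommGroup H] [InnerProductSpace ℂ H] [FiniteDimensional ℂ H]
  [NormedAddCommGroup K] [InnerProductSpace ℂ K] [FiniteDimensional ℂ K]
  [NormedAddCommGroup A] [InnerProductSpace ℂ A] [FiniteDimensional ℂ A]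
  [NormedAddCommGroup B] [InnerProductSpace ℂ B] [FiniteDimensional ℂ B]
  [NormedAddCommGroup C] [InnerProductSpace ℂ C] [FiniteDimensional ℂ C]

theorem opTensor_tmul (α : Op A) (β : Op B) :
    opTensor A B (α ⊗ₜ β) = TensorProduct.mapL α β := by
  ext z
  simp [opTensor]

theorem opTensor_rankOne (a a' : A) (b b' : B) :
    opTensor A B (rankOne ℂ a a' ⊗ₜ rankOne ℂ b b')
      = rankOne ℂ (a ⊗ₜ[ℂ] b) (a' ⊗ₜ[ℂ] b') := by
  rw [opTensor_tmul, mapL_rankOne]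

theorem tensorId_rankOne (F : Op A →ₗ[ℂ] Op C) (a a' : A) (b b' : B) :
    tensorId B F (rankOne ℂ (a ⊗ₜ[ℂ] b) (a' ⊗ₜ[ℂ] b'))
      = TensorProduct.mapL (F (rankOne ℂ a a')) (rankOne ℂ b b') := by
  rw [← opTensor_rankOne, tensorId]
  simp only [LinearMap.comp_apply, LinearEquiv.coe_coe, LinearEquiv.symm_apply_apply,
    LinearMap.rTensor_tmul]
  exact opTensor_tmul _ _

theorem ext_rankOne_tmul {M : Type*} [AddCommGroup M] [Module ℂ M]
    {Φ Ψ : Op (A ⊗[ℂ] B) →ₗ[ℂ] M}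
    (h : ∀ (a a' : A) (b b' : B), Φ (rankOne ℂ (a ⊗ₜ[ℂ] b) (a' ⊗ₜ[ℂ] b'))
      = Ψ (rankOne ℂ (a ⊗ₜ[ℂ] b) (a' ⊗ₜ[ℂ] b'))) : Φ = Ψ := by
  refine ext_rankOne fun x y => ?_
  induction x with
  | zero => simp
  | add x x' hx hx' => simp only [map_add, _root_.add_apply, hx, hx']
  | tmul a b =>
    induction y with
    | zero => simp
    | add y y' hy hy' => simp only [map_add, hy, hy']
    | tmul a' b' => exact h a a' b b'

theorem adjoint_isometry_apply (V : K →ₗᵢ[ℂ] H) (x : K) :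
    adjoint V.toContinuousLinearMap (V x) = x := by
  refine ext_inner_right ℂ fun y => ?_
  simp [adjoint_inner_left]

theorem starProjection_range_isometry (V : K →ₗᵢ[ℂ] H) :
    (LinearMap.range V.toLinearMap).starProjection
      = V.toContinuousLinearMap ∘L adjoint V.toContinuousLinearMap := by
  ext x
  refine Submodule.eq_starProjection_of_mem_of_inner_eq_zero ⟨_, rfl⟩ ?_
  rintro _ ⟨y, rfl⟩
  simp [inner_sub_left, adjoint_inner_left]

theorem compress_apply (ι : (A ⊗[ℂ] B) →ₗᵢ[ℂ] H) (σ : Op H) :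
    compress ι σ = conj ι.toContinuousLinearMap
      (conj (adjoint ι.toContinuousLinearMap) σ) := by
  change _ ∘L σ ∘L _ = _
  rw [starProjection_range_isometry]
  simp [conj_apply, comp_assoc]

end Tensor

variable {H : Type*} {A C : Type v} {B : Type*}
  [NormedAddCommGroup H] [InnerProductSpace ℂ H] [FiniteDimensional ℂ H]
  [NormedAddCommGroup A] [InnerProductSpace ℂ A] [FiniteDimensional ℂ A]
  [NormedAddCommGroup B] [InnerProductSpace ℂ B] [FiniteDimensional ℂ B]
  [NormedAddCommGroup C] [InnerProductSpace ℂ C] [FiniteDimensional ℂ C]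

/-- An identity `Φ ∘ P_AB = F ⊗ id_B` can be checked on rank one operators built from
product vectors. -/
theorem comp_compress_eq_extend_iff (ι : (A ⊗[ℂ] B) →ₗᵢ[ℂ] H) (κ : (C ⊗[ℂ] B) →ₗᵢ[ℂ] H)
    (Φ : Op H →ₗ[ℂ] Op H) (F : Op A →ₗ[ℂ] Op C) :
    Φ ∘ₗ compress ι = extend ι κ (tensorId B F) ↔
      ∀ (a a' : A) (b b' : B), Φ (rankOne ℂ (ι (a ⊗ₜ b)) (ι (a' ⊗ₜ b'))) =
        conj κ.toContinuousLinearMap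
          (TensorProduct.mapL (F (rankOne ℂ a a')) (rankOne ℂ b b')) := by
  have hΦ : Φ ∘ₗ compress ι = (Φ ∘ₗ conj ι.toContinuousLinearMap) ∘ₗ
      conj (adjoint ι.toContinuousLinearMap) := by
    ext σ : 1
    simp [compress_apply]
  rw [hΦ, extend, ← LinearMap.comp_assoc]
  constructor
  · intro h a a' b b'
    have := LinearMap.congr_fun h (rankOne ℂ (ι (a ⊗ₜ b)) (ι (a' ⊗ₜ b')))
    simpa [adjoint_isometry_apply, tensorId_rankOne] using this
  · intro h
    congr 1
    refine ext_rankOne_tmul fun a a' b b' => ?_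
    simpa [tensorId_rankOne] using h a a' b b'

end RankOne

/-! ### Extracting a tensor factor from a Gram form. -/

section Factor

variable {X H B : Type*} [AddCommGroup X] [Module ℂ X]
  [NormedAddCommGroup H] [InnerProductSpace ℂ H]
  [NormedAddCommGroup B] [InnerProductSpace ℂ B]

/-- A sesquilinear form on `B` that vanishes on orthogonal pairs is a multiple of the
inner product. -/
theorem inner_eq_mul_of_orthogonal (S T : B →ₗ[ℂ] H)
    (h : ∀ b b', inner ℂ b b' = (0 : ℂ) → inner ℂ (S b) (T b') = (0 : ℂ))
    {e : B} (he : ‖e‖ = 1) (b b' : B) :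
    inner ℂ (S b) (T b') = inner ℂ b b' * inner ℂ (S e) (T e) := by
  have hee : inner ℂ e e = (1 : ℂ) := by simp [inner_self_eq_norm_sq_to_K, he]
  have perp (d : B) (hd : inner ℂ e d = (0 : ℂ)) :
      inner ℂ (S d) (T d) = inner ℂ d d * inner ℂ (S e) (T e) := by
    have hd' : inner ℂ d e = (0 : ℂ) := inner_eq_zero_symm.mp hd
    -- These two vectors are orthogonal because `d ⟂ e` and `‖e‖ = 1`; the cross terms vanish, so
    -- the values at `d` and at `‖d‖ • e` agree.
    have := h ((‖d‖ : ℂ) • e + d) ((‖d‖ : ℂ) • e - d) (by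
      simp [hd, hd', he, sq])
    simp only [map_add, map_sub, map_smul, inner_add_left, inner_sub_right, inner_smul_left,
      inner_smul_right, h _ _ hd, h _ _ hd', Complex.conj_ofReal] at this
    rw [inner_self_eq_norm_sq_to_K]
    linear_combination -this
  have diag (b : B) : inner ℂ (S b) (T b) = inner ℂ b b * inner ℂ (S e) (T e) := by
    obtain ⟨c, d, hd, rfl⟩ : ∃ (c : ℂ) (d : B), inner ℂ e d = (0 : ℂ) ∧ b = c • e + d :=
      ⟨inner ℂ e b, b - inner ℂ e b • e, by simp [he],
        by simp⟩
    have hd' : inner ℂ d e = (0 : ℂ) := inner_eq_zero_symm.mp hd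
    simp only [map_add, map_smul, inner_add_left, inner_add_right, inner_smul_left,
      inner_smul_right, h _ _ hd, h _ _ hd', hd, hd', hee, perp d hd]
    ring
  rcases eq_or_ne b 0 with rfl | hb
  · simp
  have hbb : inner ℂ b b ≠ (0 : ℂ) := inner_self_ne_zero.mpr hb
  obtain ⟨c, d, hd, rfl⟩ : ∃ (c : ℂ) (d : B), inner ℂ b d = (0 : ℂ) ∧ b' = c • b + d :=
    ⟨inner ℂ b b' / inner ℂ b b, b' - (inner ℂ b b' / inner ℂ b b) • b, by
      rw [inner_sub_right, inner_smul_right, div_mul_cancel₀ _ hbb, sub_self], by simp⟩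
  simp only [map_add, map_smul, inner_add_right, inner_smul_right, h _ _ hd, hd, diag b]
  ring

/-- A bilinear map `W` into a Hilbert space whose Gram form is a multiple of the inner product
in the second variable factors through an isometric embedding of a tensor product. -/
theorem exists_isometry_factor [FiniteDimensional ℂ H] (W : X →ₗ[ℂ] B →ₗ[ℂ] H)
    {e : B}
    (hW : ∀ x x' b b', inner ℂ (W x b) (W x' b') = inner ℂ b b' * inner ℂ (W x e) (W x' e)) :
    ∃ (C : Type v) (_ : NormedAddCommGroup C) (_ : InnerProductSpace ℂ C)
      (_ : FiniteDimensional ℂ C) (κ : (C ⊗[ℂ] B) →ₗᵢ[ℂ] H) (g : X →ₗ[ℂ] C),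
      ∀ x b, κ (g x ⊗ₜ b) = W x b := by
  let D := LinearMap.range (W.flip e)
  -- `D` is the wanted factor, but lies in the universe of `H`; a lifted coordinate space is a copy
  -- of it in universe `v`.
  let ψ : D ≃ₗᵢ[ℂ] EuclideanSpace ℂ (ULift.{v} (Fin (Module.finrank ℂ D))) :=
    ((stdOrthonormalBasis ℂ D).reindex Equiv.ulift.symm).repr
  obtain ⟨s, hs⟩ := (W.flip e).rangeRestrict.exists_rightInverse_of_surjective
    (LinearMap.range_rangeRestrict _)
  have hs' (d : D) : W (s d) e = d := congrArg Subtype.val (LinearMap.congr_fun hs d)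
  let T : EuclideanSpace ℂ (ULift.{v} (Fin (Module.finrank ℂ D))) ⊗[ℂ] B →ₗ[ℂ] H :=
    TensorProduct.lift (W ∘ₗ s ∘ₗ ψ.symm.toLinearEquiv.toLinearMap)
  have hT (c b) : T (c ⊗ₜ b) = W (s (ψ.symm c)) b := rfl
  refine ⟨_, inferInstance, inferInstance, inferInstance, T.isometryOfInner fun x y => ?_,
    ψ.toLinearEquiv.toLinearMap ∘ₗ (W.flip e).rangeRestrict, fun x b => ?_⟩
  · refine inner_tmul_ext (S := T) (T := T) (S' := .id) (T' := .id) (fun c c' b b' => ?_) x y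
    rw [hT, hT, hW, hs', hs', ← Submodule.coe_inner, ψ.symm.inner_map_map]
    simp [mul_comm]
  · let u := s ((W.flip e).rangeRestrict x) - x
    have hu : W u e = 0 := by
      simp [u, hs']
    have : W u b = 0 := by
      rw [← inner_self_eq_zero (𝕜 := ℂ), hW, hu]
      simp
    change T (ψ ((W.flip e).rangeRestrict x) ⊗ₜ b) = W x b
    rw [hT, ψ.symm_apply_apply, ← sub_eq_zero, ← LinearMap.sub_apply, ← map_sub]
    exact this

end Factor

/-! ### Traces of channels and elementary channels. -/

section Channels

theorem mapL_rankOne_apply_mem {A B : Type*} [NormedAddCommGroup A] [InnerProductSpace ℂ A]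
    [NormedAddCommGroup B] [InnerProductSpace ℂ B]
    (γ : Op A) (b b' : B) (z : A ⊗[ℂ] B) :
    TensorProduct.mapL γ (rankOne ℂ b b') z
      ∈ LinearMap.range ((TensorProduct.mk ℂ A B).flip b) := by
  induction z with
  | zero => simp
  | add x y hx hy => rw [map_add]; exact add_mem hx hy
  | tmul x y =>
    exact ⟨inner ℂ b' y • γ x, by simp [TensorProduct.smul_tmul']⟩

theorem sum_inner_rankOne {H K : Type*} [NormedAddCommGroup H] [InnerProductSpace ℂ H]
    [NormedAddCommGroup K] [InnerProductSpace ℂ K] {ι : Type*} [Fintype ι]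
    (b : OrthonormalBasis ι ℂ H) {k : K} (hk : ‖k‖ = 1) (x y : H) :
    ∑ i, inner ℂ (rankOne ℂ k (b i) x) (rankOne ℂ k (b i) y) = inner ℂ x y := by
  simp [hk, mul_comm, ← b.sum_inner_mul_inner x y]

variable {H K : Type*}
  [NormedAddCommGroup H] [InnerProductSpace ℂ H] [FiniteDimensional ℂ H]
  [NormedAddCommGroup K] [InnerProductSpace ℂ K] [FiniteDimensional ℂ K]

theorem Channel.trace_rankOne (Φ : Channel H K) (x y : H) :
    LinearMap.trace ℂ K (Φ.toLinearMap (rankOne ℂ x y) : K →ₗ[ℂ] K) = inner ℂ y x := by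
  rw [Φ.trace_preserving, InnerProductSpace.trace_rankOne]

/-- Kraus operators of a channel form an isometry. -/
theorem Channel.sum_inner_kraus (Φ : Channel H K) {ι : Type*} [Fintype ι]
    {V : ι → H →L[ℂ] K} (hV : Φ.toLinearMap = ∑ i, conj (V i)) (x y : H) :
    ∑ i, inner ℂ (V i x) (V i y) = inner ℂ x y := by
  rw [← Φ.trace_rankOne, hV]
  simp [InnerProductSpace.trace_rankOne]

variable (H) in
/-- The identity channel. -/
noncomputable def Channel.id : Channel H H :=
  .ofKraus (fun _ : Unit => ContinuousLinearMap.id ℂ H) (by simp)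

@[simp]
theorem Channel.id_apply (σ : Op H) : (Channel.id H).toLinearMap σ = σ := by
  refine LinearMap.congr_fun (ext_rankOne (Ψ := LinearMap.id) fun x y => ?_) σ
  simp [Channel.id]

/-- The channel that replaces every state by the pure state of the unit vector `k`. -/
noncomputable def Channel.replace (k : K) (hk : ‖k‖ = 1) : Channel H K :=
  .ofKraus _ (sum_inner_rankOne (stdOrthonormalBasis ℂ H) hk)

theorem Channel.replace_rankOne (k : K) (hk : ‖k‖ = 1) (x y : H) :
    (Channel.replace k hk).toLinearMap (rankOne ℂ x y)
      = (inner ℂ y x : ℂ) • rankOne ℂ k k := by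
  simp [Channel.replace, smul_smul, ← Finset.sum_smul, mul_comm,
    ← (stdOrthonormalBasis ℂ H).sum_inner_mul_inner y x]

end Channels

variable {H : Type*} {A : Type v} {B : Type*}
  [NormedAddCommGroup H] [InnerProductSpace ℂ H] [FiniteDimensional ℂ H]
  [NormedAddCommGroup A] [InnerProductSpace ℂ A] [FiniteDimensional ℂ A]
  [NormedAddCommGroup B] [InnerProductSpace ℂ B] [FiniteDimensional ℂ B]

/-! ### Unitary recoverability implies correctability. -/

section Recover

variable {C : Type v} [NormedAddCommGroup C] [InnerProductSpace ℂ C] [FiniteDimensional ℂ C]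

/-- The normalization of the Kraus operators `|a⟩⟨c m| ⊗ 1`: their products with adjoints on the
left sum to `∑ |c m⟩⟨c m| ⊗ 1 = 1`. -/
theorem sum_inner_rTensor_rankOne {n : Type*} [Fintype n] (c : OrthonormalBasis n ℂ C) {a : A}
    (ha : ‖a‖ = 1) (z w : C ⊗[ℂ] B) :
    ∑ m, inner ℂ ((rankOne ℂ a (c m)).rTensor B z) ((rankOne ℂ a (c m)).rTensor B w)
      = inner ℂ z w := by
  have h (m) : inner ℂ ((rankOne ℂ a (c m)).rTensor B z) ((rankOne ℂ a (c m)).rTensor B w)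
      = inner ℂ z ((rankOne ℂ (c m) (c m)).rTensor B w) := by
    rw [← adjoint_inner_right, adjoint_rTensor, adjoint_rankOne, ← comp_apply, ← rTensor_comp]
    congr 3
    ext x
    simp [ha]
  have hs : ∑ m, (rankOne ℂ (c m) (c m)).rTensor B = .id ℂ (C ⊗[ℂ] B) := by
    simp_rw [rTensor_eq_mapL]
    rw [← mapL_sum_left, c.sum_rankOne_eq_id, TensorProduct.mapL_id_id]
  have hw : w = ∑ m, (rankOne ℂ (c m) (c m)).rTensor B w := by
    rw [← _root_.sum_apply, hs, id_apply]
  simp_rw [h]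
  conv_rhs => rw [hw, inner_sum]

theorem sum_conj_rTensor_rankOne {n : Type*} [Fintype n] (c : OrthonormalBasis n ℂ C) (a : A)
    (γ : Op C) (β : Op B) :
    ∑ m, conj ((rankOne ℂ a (c m)).rTensor B) (TensorProduct.mapL γ β)
      = LinearMap.trace ℂ C (γ : C →ₗ[ℂ] C) • TensorProduct.mapL (rankOne ℂ a a) β := by
  have h : LinearMap.trace ℂ C (γ : C →ₗ[ℂ] C) = ∑ m, (inner ℂ (c m) (γ (c m)) : ℂ) :=
    LinearMap.trace_eq_sum_inner _ c
  simp_rw [conj_apply, adjoint_rTensor, adjoint_rankOne, mapL_comp_rTensor, rTensor_comp_mapL]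
  rw [← mapL_sum_left, ← TensorProduct.mapL_smul_left, h, Finset.sum_smul]
  congr 1
  refine Finset.sum_congr rfl fun m _ => ?_
  ext x
  simp [smul_smul, mul_comm]

/-- A decoder: compress to `C ⊗ B`, discard `C` and prepare a pure state of `A` instead. -/
theorem exists_channel_reset (ι : (A ⊗[ℂ] B) →ₗᵢ[ℂ] H) (κ : (C ⊗[ℂ] B) →ₗᵢ[ℂ] H)
    {U : Op H} (hU : U ∈ unitary (Op H)) {a : A} (ha : ‖a‖ = 1) {k : H} (hk : ‖k‖ = 1) :
    ∃ R : Channel H H, ∀ (X : Op H) (γ : Op C) (β : Op B),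
      conj U X = conj κ.toContinuousLinearMap (TensorProduct.mapL γ β) →
      R.toLinearMap X = LinearMap.trace ℂ C (γ : C →ₗ[ℂ] C) •
        conj ι.toContinuousLinearMap (TensorProduct.mapL (rankOne ℂ a a) β) := by
  let c := stdOrthonormalBasis ℂ C
  let b := stdOrthonormalBasis ℂ H
  let κ' := adjoint κ.toContinuousLinearMap
  let Q : Op H := 1 - κ.toContinuousLinearMap ∘L κ'
  -- The first family resets `C` to `a`. The second sends the complement of `C ⊗ B` to the state
  -- `k`; it is needed only for trace preservation and vanishes on the operators of interest.
  let V : Fin (Module.finrank ℂ C) ⊕ Fin (Module.finrank ℂ H) → Op H :=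
    Sum.elim (fun m => (ι.toContinuousLinearMap ∘L (rankOne ℂ a (c m)).rTensor B ∘L κ') ∘L U)
      fun n => (rankOne ℂ k (b n) ∘L Q) ∘L U
  have hUU (x y : H) : inner ℂ (U x) (U y) = inner ℂ x y := by
    rw [← adjoint_inner_right, ← star_eq_adjoint, ← mul_apply_eq_comp,
      Unitary.star_mul_self_of_mem hU, one_apply_eq_self]
  have hκ (z) : κ' (κ z) = z := adjoint_isometry_apply κ z
  refine ⟨.ofKraus V fun x y => ?_, fun X γ β h => ?_⟩
  · simp only [V, Fintype.sum_sum_type, Sum.elim_inl, Sum.elim_inr, comp_apply,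
      LinearIsometry.coe_toContinuousLinearMap, LinearIsometry.inner_map_map]
    rw [sum_inner_rTensor_rankOne c ha, sum_inner_rankOne b hk, ← hUU x y]
    have hQ (p q : H) : inner ℂ (Q p) (Q q) = inner ℂ p q - inner ℂ (κ' p) (κ' q) := by
      have h1 (p q : H) : inner ℂ p (κ (κ' q)) = inner ℂ (κ' p) (κ' q) :=
        (adjoint_inner_left κ.toContinuousLinearMap _ _).symm
      have h2 (p q : H) : inner ℂ (κ (κ' p)) q = inner ℂ (κ' p) (κ' q) :=
        (adjoint_inner_right κ.toContinuousLinearMap _ _).symm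
      change inner ℂ (p - κ (κ' p)) (q - κ (κ' q)) = _
      rw [inner_sub_left, inner_sub_right, inner_sub_right, h1, h2, κ.inner_map_map]
      ring
    rw [hQ, add_sub_cancel]
  · have h1 : κ' ∘L κ.toContinuousLinearMap = .id ℂ _ := by
      ext z
      exact hκ z
    have h2 : Q ∘L κ.toContinuousLinearMap = 0 := by
      ext z
      simp [Q, hκ]
    rw [Channel.ofKraus_toLinearMap, LinearMap.sum_apply, Fintype.sum_sum_type]
    simp only [V, Sum.elim_inl, Sum.elim_inr]
    simp_rw [conj_comp _ U, h, ← conj_comp, comp_assoc, h1, h2]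
    simp_rw [conj_comp ι.toContinuousLinearMap]
    rw [← map_sum]
    simp only [comp_id, comp_zero, conj_zero, Finset.sum_const_zero, add_zero,
      sum_conj_rTensor_rankOne, map_smul]

theorem IsUnitarilyRecoverable.isCorrectable {ι : (A ⊗[ℂ] B) →ₗᵢ[ℂ] H} {E : Channel H H}
    (h : IsUnitarilyRecoverable ι E) : IsCorrectable ι E := by
  obtain ⟨U, hU, C, _, _, _, κ, F, h⟩ := h
  rw [← LinearMap.comp_assoc, comp_compress_eq_extend_iff] at h
  -- Without unit vectors in `A` and `B` all product vectors vanish, and any channels will do.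
  by_cases hAB : Subsingleton A ∨ Subsingleton B
  · refine ⟨.id H, .id A, ?_⟩
    rw [← LinearMap.comp_assoc, comp_compress_eq_extend_iff]
    intro a a' b b'
    rcases hAB with hA | hB
    · simp [Subsingleton.elim a 0]
    · simp [Subsingleton.elim b 0]
  rw [not_or, not_subsingleton_iff_nontrivial, not_subsingleton_iff_nontrivial] at hAB
  obtain ⟨hA, hB⟩ := hAB
  obtain ⟨a₀, ha₀⟩ := exists_norm_eq A zero_le_one
  obtain ⟨b₀, hb₀⟩ := exists_norm_eq B zero_le_one
  have hk : ‖ι (a₀ ⊗ₜ b₀)‖ = 1 := by simp [ha₀, hb₀]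
  obtain ⟨R, hR⟩ := exists_channel_reset ι κ hU ha₀ hk
  refine ⟨R, .replace a₀ ha₀, ?_⟩
  rw [← LinearMap.comp_assoc, comp_compress_eq_extend_iff]
  intro a a' b b'
  -- Trace preservation of `F` turns the scalar left by discarding `C` into `⟨a', a⟩`, the scalar
  -- produced by `Channel.replace`.
  rw [LinearMap.comp_apply, hR _ _ _ (h a a' b b'), F.trace_rankOne, Channel.replace_rankOne,
    TensorProduct.mapL_smul_left, map_smul]

end Recover

/-! ### Correctability implies unitary recoverability. -/

section Correct

/-- If a sum of `|v⟩⟨v|` has its range in `S`, then every `v` lies in `S`. -/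
theorem mem_of_sum_rankOne_apply_mem {n : Type*} [Fintype n] (v : n → H) (S : Submodule ℂ H)
    (h : ∀ y, (∑ i, rankOne ℂ (v i) (v i)) y ∈ S) (i : n) : v i ∈ S := by
  rw [← Submodule.orthogonal_orthogonal S, Submodule.mem_orthogonal']
  intro y hy
  have h0 : inner ℂ ((∑ i, rankOne ℂ (v i) (v i)) y) y = (0 : ℂ) := hy _ (h y)
  have h1 : inner ℂ ((∑ i, rankOne ℂ (v i) (v i)) y) y =
      ((∑ i, ‖inner ℂ (v i) y‖ ^ 2 : ℝ) : ℂ) := by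
    have h (i) : inner ℂ (v i) y * inner ℂ y (v i) = (‖inner ℂ (v i) y‖ : ℂ) ^ 2 := by
      rw [← inner_conj_symm y, Complex.mul_conj']
    simp [h]
  rw [h1, Complex.ofReal_eq_zero, Finset.sum_eq_zero_iff_of_nonneg fun _ _ => by positivity] at h0
  simpa using h0 i (Finset.mem_univ i)

theorem IsCorrectable.isUnitarilyRecoverable {ι : (A ⊗[ℂ] B) →ₗᵢ[ℂ] H} {E : Channel H H}
    (h : IsCorrectable ι E) : IsUnitarilyRecoverable ι E := by
  obtain ⟨R, F, h⟩ := h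
  rw [← LinearMap.comp_assoc, comp_compress_eq_extend_iff] at h
  rcases subsingleton_or_nontrivial B with hB | hB
  · refine ⟨1, one_mem _, A, inferInstance, inferInstance, inferInstance, ι, .id A, ?_⟩
    rw [← LinearMap.comp_assoc, comp_compress_eq_extend_iff]
    intro a a' b b'
    simp [Subsingleton.elim b 0]
  obtain ⟨b₀, hb₀⟩ := exists_norm_eq B zero_le_one
  obtain ⟨n, e, he⟩ := exists_kraus E.toCompletelyPositiveMap
  obtain ⟨m, r, hr⟩ := exists_kraus R.toCompletelyPositiveMap
  have hmem (i j) (a : A) (b : B) : ∃ a', r j (e i (ι (a ⊗ₜ b))) = ι (a' ⊗ₜ[ℂ] b) := by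
    have := mem_of_sum_rankOne_apply_mem
      (fun p : Fin m × Fin n => r p.1 (e p.2 (ι (a ⊗ₜ b))))
      ((LinearMap.range ((TensorProduct.mk ℂ A B).flip b)).map ι.toLinearMap) (fun y => by
        have hab := h a a b b
        rw [he, hr] at hab
        rw [Fintype.sum_prod_type_right]
        simp only [LinearMap.comp_apply, LinearMap.sum_apply, map_sum, conj_rankOne] at hab
        rw [hab]
        exact Submodule.mem_map_of_mem (mapL_rankOne_apply_mem _ b b _)) (j, i)
    obtain ⟨_, ⟨a', rfl⟩, h'⟩ := this
    exact ⟨a', h'.symm⟩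
  -- Joining all Kraus operators in one bilinear map yields a single `C` and `κ` that serve every `e
  -- i`.
  let W : (Fin n → A) →ₗ[ℂ] B →ₗ[ℂ] H :=
    ∑ i, (TensorProduct.mk ℂ A B).compr₂ ((e i).toLinearMap ∘ₗ ι.toLinearMap) ∘ₗ
      LinearMap.proj i
  have hWx (x b) : W x b = ∑ i, e i (ι (x i ⊗ₜ b)) := by
    simp [W, LinearMap.sum_apply]
  have hW0 (x x' b b') (hbb : inner ℂ b b' = (0 : ℂ)) :
      inner ℂ (W x b) (W x' b') = (0 : ℂ) := by
    rw [hWx, hWx]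
    simp only [sum_inner, inner_sum]
    refine Finset.sum_eq_zero fun i _ => Finset.sum_eq_zero fun k _ => ?_
    -- The inner product is computed after the isometry formed by the `r j`, where `hmem` puts the
    -- vectors in `A ⊗ b` and `A ⊗ b'`.
    rw [← R.sum_inner_kraus hr]
    refine Finset.sum_eq_zero fun j _ => ?_
    obtain ⟨a₁, h₁⟩ := hmem k j (x k) b
    obtain ⟨a₂, h₂⟩ := hmem i j (x' i) b'
    simp [h₁, h₂, hbb]
  obtain ⟨C, _, _, _, κ, g, hg⟩ := exists_isometry_factor.{v} W fun x x' b b' =>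
    inner_eq_mul_of_orthogonal (W x) (W x') (hW0 x x') hb₀ b b'
  let f (i : Fin n) : A →L[ℂ] C := LinearMap.toContinuousLinearMap
    (g ∘ₗ LinearMap.single ℂ (fun _ => A) i)
  have hf (i a b) : κ (f i a ⊗ₜ b) = e i (ι (a ⊗ₜ b)) := by
    change κ (g (Pi.single i a) ⊗ₜ b) = _
    rw [hg, hWx, Finset.sum_eq_single i]
    · simp
    · intro k _ hk
      simp [hk]
    · simp
  refine ⟨1, one_mem _, C, inferInstance, inferInstance, inferInstance, κ,
    .ofKraus f fun x y => ?_, ?_⟩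
  · calc ∑ i, inner ℂ (f i x) (f i y)
        = ∑ i, inner ℂ (e i (ι (x ⊗ₜ b₀))) (e i (ι (y ⊗ₜ b₀))) := by
          simp [← hf, hb₀]
      _ = inner ℂ x y := by
          rw [E.sum_inner_kraus he]
          simp [hb₀]
  · rw [← LinearMap.comp_assoc, comp_compress_eq_extend_iff]
    intro a a' b b'
    rw [LinearMap.comp_apply, he, Channel.ofKraus_toLinearMap]
    have hs : TensorProduct.mapL ((∑ i, conj (f i)) (rankOne ℂ a a')) (rankOne ℂ b b')
        = ∑ i, rankOne ℂ (f i a ⊗ₜ[ℂ] b) (f i a' ⊗ₜ[ℂ] b') := by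
      simp only [LinearMap.sum_apply, conj_rankOne, mapL_sum_left, mapL_rankOne]
    rw [hs]
    simp [hf]

end Correct

end QuantumSubsystem

/-- Let `H = (A ⊗ B) ⊕ K` and let `E` be a quantum channel on `H`. Then `B` is correctable for `E`
if and only if `B` is unitarily recoverable for `E`. -/
theorem theorem1 {H : Type*} {A : Type*} {B : Type*}
    [NormedAddCommGroup H] [InnerProductSpace ℂ H] [FiniteDimensional ℂ H]
    [NormedAddCommGroup A] [InnerProductSpace ℂ A] [FiniteDimensional ℂ A]
    [NormedAddCommGroup B] [InnerProductSpace ℂ B] [FiniteDimensional ℂ B]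
    (ι : TensorProduct ℂ A B →ₗᵢ[ℂ] H) (E : QuantumSubsystem.Channel H H) :
    QuantumSubsystem.IsCorrectable ι E ↔ QuantumSubsystem.IsUnitarilyRecoverable ι E :=
  ⟨fun h => h.isUnitarilyRecoverable, fun h => h.isCorrectable⟩
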